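/- Let $n\ge 1$, $m\ge 1$, $d\ge 0$ be integers and put $D_k=\binom{k+n-1}{k}$, the dimension of the space of homogeneous polynomials of degree $k$ in $z_1,\dots,z_n$. For integers $m\ge 1$ and $c\ge 1$, the $m$-th Macaulay representation of $c$ is the unique way of writing $c=\binom{k_m}{m}+\binom{k_{m-1}}{m-1}+\dots+\binom{k_J}{J}$ with $k_m>k_{m-1}>\dots>k_J\ge J>0$, and one sets $c^{<m>}=\binom{k_m+1}{m+1}+\binom{k_{m-1}+1}{m}+\dots+\binom{k_J+1}{J+1}$; for $c=0$ the representation is the empty sum and $0^{<m>}=0$. Let $r(z,\bar z)=\sum_{|\alpha|=|\beta|=m}c_{\alpha\beta}z^\alpha\bar z^\beta$ be a real-valued bihomogeneous polynomial of bidegree $(m,m)$ on $\mathbb C^n$. Its coefficient matrix $(c_{\alpha\beta})$ is Hermitian; let $R$ be the rank of this matrix and $(P,N)$ its signature, i.e. the numbers of positive and of negative eigenvalues counted with multiplicity, so that $R=P+N$. Suppose that $r(z,\bar z)\|z\|^{2d}$ is a squared norm, i.e. there are $K$ and holomorphic polynomials $h_1,\dots,h_K$ on $\mathbb C^n$ with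 $r(z,\bar z)\|z\|^{2d}=\sum_{k=1}^K|h_k(z)|^2$ for all $z\in\mathbb C^n$. Then, with $H(m)=D_m-R$, $$P\;\ge\;\frac{D_{m+d}-[[H(m)^{<m>}]^{<m+1>}\cdots]^{<m+d-1>}}{D_d},$$ where the operations $c\mapsto c^{<j>}$ are applied successively for $j=m,m+1,\dots,m+d-1$ (none if $d=0$). Moreover, if $D_m-R=\sum_{j=J}^m\binom{k_j}{j}$ is the $m$-th Macaulay representation of $D_m-R$, then $$[[H(m)^{<m>}]^{<m+1>}\cdots]^{<m+d-1>}=\sum_{j=J}^m\binom{k_j+d}{j+d},$$ so that the inequality is equivalent to $$P\;\ge\;\frac{D_{m+d}-\sum_{j=J}^m\binom{k_j+d}{j+d}}{D_d}.$$ -/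

import Mathlib

open MvPolynomial

namespace SquaredNorm

/-- A polynomial in `z` and `z̄` is a polynomial in two groups of `n` variables: `X (Sum.inl i)`
stands for `z i` and `X (Sum.inr i)` for `conj (z i)`.  This is its value at `z`. -/
noncomputable def evalConj {n : ℕ} (r : MvPolynomial (Fin n ⊕ Fin n) ℂ)
    (z : EuclideanSpace ℂ (Fin n)) : ℂ :=
  eval (Sum.elim (fun i => z i) (fun i => (starRingEnd ℂ) (z i))) r

/-- `r(z, z̄)` is real for all `z`. -/
def IsRealValued {n : ℕ} (r : MvPolynomial (Fin n ⊕ Fin n) ℂ) : Prop :=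
  ∀ z : EuclideanSpace ℂ (Fin n), (evalConj r z).im = 0

/-- Every monomial of `r` has degree `a` in `z` and degree `b` in `z̄`. -/
def IsBihomogeneous {n : ℕ} (r : MvPolynomial (Fin n ⊕ Fin n) ℂ) (a b : ℕ) : Prop :=
  ∀ s ∈ r.support, ∑ i, s (Sum.inl i) = a ∧ ∑ i, s (Sum.inr i) = b

/-- `r(z, z̄) ‖z‖ ^ (2 d)` is the squared norm of a holomorphic polynomial mapping
`h : ℂⁿ → ℂᴷ` for some `K`. -/
def MulNormPowIsSquaredNorm {n : ℕ} (r : MvPolynomial (Fin n ⊕ Fin n) ℂ) (d : ℕ) : Prop :=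
  ∃ (K : ℕ) (h : Fin K → MvPolynomial (Fin n) ℂ), ∀ z : EuclideanSpace ℂ (Fin n),
    evalConj r z * ((‖z‖ ^ (2 * d) : ℝ) : ℂ) =
      ((∑ k, ‖eval (fun i => z i) (h k)‖ ^ 2 : ℝ) : ℂ)

/-- The multi-indices of degree `m` in `n` variables. -/
abbrev MultiIndex (n m : ℕ) : Type :=
  {α : Fin n →₀ ℕ // α ∈ Finset.finsuppAntidiag Finset.univ m}

/-- The matrix whose entry `(α, β)`, `|α| = |β| = m`, is the coefficient of `z ^ α * z̄ ^ β`. -/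
noncomputable def coeffMatrix {n : ℕ} (r : MvPolynomial (Fin n ⊕ Fin n) ℂ) (m : ℕ) :
    Matrix (MultiIndex n m) (MultiIndex n m) ℂ :=
  fun α β => r.coeff (Finsupp.sumElim α.1 β.1)

/-- A polynomial in `z, z̄` that vanishes identically has zero coefficients. -/
theorem eq_zero_of_evalConj {n : ℕ} (p : MvPolynomial (Fin n ⊕ Fin n) ℂ)
    (hp : ∀ z : EuclideanSpace ℂ (Fin n), evalConj p z = 0) : p = 0 := by
  have key : bind₁ (Sum.elim
      (fun i : Fin n => (X (Sum.inl i) + C Complex.I * X (Sum.inr i) :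
        MvPolynomial (Fin n ⊕ Fin n) ℂ))
      (fun i => X (Sum.inl i) - C Complex.I * X (Sum.inr i))) p = 0 := by
    refine funext_set (fun _ => Set.range ((↑) : ℝ → ℂ))
      (fun _ => Set.infinite_range_of_injective Complex.ofReal_injective) ?_
    intro x hx
    have hx' : ∀ i, ∃ y : ℝ, (y : ℂ) = x i := fun i => hx i (Set.mem_univ i)
    choose y hy using hx'
    rw [map_zero, ← hp (WithLp.toLp 2 (fun i => x (Sum.inl i) + Complex.I * x (Sum.inr i)))]
    unfold evalConj
    rw [← coe_aeval_eq_eval, RingHom.coe_coe, aeval_bind₁, ← coe_aeval_eq_eval, RingHom.coe_coe]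
    congr 2
    funext i
    rcases i with i | i
    · simp
    · simp [← hy, sub_eq_add_neg]
  refine MvPolynomial.funext fun w => ?_
  have h := congrArg (aeval (Sum.elim
      (fun i : Fin n => (w (Sum.inl i) + w (Sum.inr i)) / 2)
      (fun i => (w (Sum.inl i) - w (Sum.inr i)) / (2 * Complex.I)))) key
  rw [aeval_bind₁, map_zero] at h
  rw [map_zero, ← h, ← coe_aeval_eq_eval, RingHom.coe_coe]
  congr 2
  funext i
  have hI := Complex.I_ne_zero
  rcases i with i | i
  · simp
    field_simp
    ring
  · simp
    field_simp
    ring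

/-- The coefficient matrix of a real-valued polynomial is Hermitian. -/
theorem IsRealValued.isHermitian {n : ℕ} {r : MvPolynomial (Fin n ⊕ Fin n) ℂ}
    (hr : IsRealValued r) (m : ℕ) : (coeffMatrix r m).IsHermitian := by
  have h : r - rename Sum.swap (map (starRingEnd ℂ) r) = 0 := by
    refine eq_zero_of_evalConj _ fun z => ?_
    have h1 : evalConj (rename Sum.swap (map (starRingEnd ℂ) r)) z
        = (starRingEnd ℂ) (evalConj r z) := by
      unfold evalConj
      rw [eval_rename, eval_map, ← eval₂_id,
        ← coe_eval₂Hom, ← coe_eval₂Hom, ← RingHom.comp_apply, comp_eval₂Hom]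
      simp only [RingHom.comp_id]
      congr 2
      funext i
      rcases i with i | i <;> simp
    have h2 : (starRingEnd ℂ) (evalConj r z) = evalConj r z := Complex.conj_eq_iff_im.2 (hr z)
    have h3 : evalConj (r - rename Sum.swap (map (starRingEnd ℂ) r)) z
        = evalConj r z - evalConj (rename Sum.swap (map (starRingEnd ℂ) r)) z := map_sub _ _ _
    rw [h3, h1, h2, sub_self]
  ext α β
  have hsw : Finsupp.sumElim α.1 β.1
      = (Finsupp.sumElim β.1 α.1).mapDomain (Sum.swap : Fin n ⊕ Fin n → Fin n ⊕ Fin n) := by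
    ext i
    have := Finsupp.mapDomain_apply (f := (Sum.swap : Fin n ⊕ Fin n → Fin n ⊕ Fin n))
      (Sum.swap_leftInverse.injective) (Finsupp.sumElim β.1 α.1) i.swap
    rw [Sum.swap_swap] at this
    rw [this]
    rcases i with i | i <;> simp
  have h4 : r.coeff (Finsupp.sumElim α.1 β.1)
      = (starRingEnd ℂ) (r.coeff (Finsupp.sumElim β.1 α.1)) := by
    conv_lhs => rw [sub_eq_zero.1 h, hsw]
    rw [coeff_rename_mapDomain _ Sum.swap_leftInverse.injective, coeff_map]
  rw [Matrix.conjTranspose_apply]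
  exact h4.symm

/-- The signature pair of a Hermitian matrix: the numbers of positive and of negative
eigenvalues, counted with multiplicity. -/
noncomputable def hermitianSignature {ι : Type*} [Fintype ι] [DecidableEq ι] {A : Matrix ι ι ℂ}
    (hA : A.IsHermitian) : ℕ × ℕ :=
  (Nat.card {i // 0 < hA.eigenvalues i}, Nat.card {i // hA.eigenvalues i < 0})

/-- The dimension of the space of homogeneous polynomials of degree `k` in `n ≥ 1` variables. -/
def polyDim (n k : ℕ) : ℕ := (k + n - 1).choose k

/-- `c = ∑_{j=J}^{m} (k j choose j)` with `k m > k (m-1) > ⋯ > k J ≥ J > 0`.  For `c = 0` the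
representation is the empty sum, which is the case `J = m + 1`. -/
structure IsMacaulayRep (m c J : ℕ) (k : ℕ → ℕ) : Prop where
  pos : 0 < J
  le : J ≤ m + 1
  strict : ∀ i j, J ≤ i → i < j → j ≤ m → k i < k j
  ge : J ≤ m → J ≤ k J
  sum : c = ∑ j ∈ Finset.Icc J m, (k j).choose j

theorem exists_isMacaulayRep_lt (m : ℕ) : ∀ c b : ℕ, c < b.choose (m + 1) →
    ∃ J k, IsMacaulayRep (m + 1) c J k ∧ (J ≤ m + 1 → k (m + 1) < b) := by
  induction m with
  | zero =>
    intro c b hc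
    rcases Nat.eq_zero_or_pos c with rfl | h
    · exact ⟨2, fun _ => 0, ⟨by omega, by omega, by intros; omega, by omega, by simp⟩, by omega⟩
    · refine ⟨1, fun _ => c, ⟨by omega, by omega, by intros; omega, by intro; omega, by simp⟩, ?_⟩
      intro _
      simpa using hc
  | succ m ih =>
    intro c b hc
    rcases Nat.eq_zero_or_pos c with rfl | h
    · exact ⟨m + 3, fun _ => 0, ⟨by omega, by omega, by intros; omega, by omega, by simp⟩,
        by omega⟩
    · have hex : ∃ a, c < (a + 1).choose (m + 2) := by
        rcases b with _ | b
        · simp at hc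
        · exact ⟨b, hc⟩
      obtain ⟨a, h1, hmin⟩ : ∃ a, c < (a + 1).choose (m + 2) ∧
          ∀ i < a, ¬ c < (i + 1).choose (m + 2) := by
        classical
        exact ⟨Nat.find hex, Nat.find_spec hex, fun i hi => Nat.find_min hex hi⟩
      have h2 : a.choose (m + 2) ≤ c := by
        rcases a with _ | a'
        · simp
        · exact not_lt.1 (hmin a' (by omega))
      have hab : a < b := by
        by_contra! hlt
        have h0 : b.choose (m + 2) ≤ a.choose (m + 2) := Nat.choose_le_choose (m + 2) hlt
        have h0' : c < b.choose (m + 2) := hc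
        omega
      have h3 : c - a.choose (m + 2) < a.choose (m + 1) := by
        have h0 : (a + 1).choose (m + 2) = a.choose (m + 1) + a.choose (m + 2) :=
          Nat.choose_succ_succ' a (m + 1)
        omega
      obtain ⟨J, k, hk, hka⟩ := ih _ _ h3
      have hm : m + 2 ≤ a := by
        by_contra! hlt
        have : (a + 1).choose (m + 2) ≤ 1 := by
          rcases Nat.lt_or_ge (a + 1) (m + 2) with h | h
          · rw [Nat.choose_eq_zero_of_lt h]; omega
          · have : a + 1 = m + 2 := by omega
            rw [this, Nat.choose_self]
        omega
      refine ⟨J, fun j => if j = m + 2 then a else k j,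
        ⟨hk.pos, by have := hk.le; omega, ?_, ?_, ?_⟩, fun _ => by simpa using hab⟩
      · intro i j hi hij hj
        have hi' : i ≠ m + 2 := by omega
        rcases Nat.lt_or_ge j (m + 2) with h | h
        · have := hk.strict i j hi hij (by omega)
          simpa [hi', h.ne] using this
        · have hj' : j = m + 2 := by omega
          simp only [hi', hj', if_true, if_false]
          rcases Nat.lt_or_ge i (m + 1) with h' | h'
          · exact (hk.strict i (m + 1) hi h' le_rfl).trans (hka (by omega))
          · have : i = m + 1 := by omega
            subst this
            exact hka hi
      · intro _
        by_cases hJ : J = m + 2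
        · simp only [hJ, if_true]; omega
        · have h5 := hk.le
          simp only [hJ, if_false]
          exact hk.ge (by omega)
      · have hJ : J ≤ m + 1 + 1 := hk.le
        rw [Finset.sum_Icc_succ_top hJ]
        have : ∑ j ∈ Finset.Icc J (m + 1), (if j = m + 2 then a else k j).choose j
            = ∑ j ∈ Finset.Icc J (m + 1), (k j).choose j := by
          refine Finset.sum_congr rfl fun j hj => ?_
          have := (Finset.mem_Icc.1 hj).2
          rw [if_neg (by omega)]
        rw [this, ← hk.sum]
        have h6 : (if m + 1 + 1 = m + 2 then a else k (m + 1 + 1)).choose (m + 1 + 1)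
            = a.choose (m + 2) := by simp
        rw [h6]
        omega

/-- For `m ≥ 1` every natural number has an `m`-th Macaulay representation. -/
theorem exists_isMacaulayRep {m : ℕ} (hm : 1 ≤ m) (c : ℕ) : ∃ J k, IsMacaulayRep m c J k := by
  obtain ⟨m, rfl⟩ : ∃ m', m = m' + 1 := ⟨m - 1, by omega⟩
  obtain ⟨J, k, h, -⟩ := exists_isMacaulayRep_lt m c (c + m + 1) (by
    rcases m with _ | m
    · simp
    · have h1 : (c + (m + 1) + 1).choose (m + 1 + 1) ≥ (c + 1 + m + 1).choose (m + 1 + 1) :=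
        Nat.choose_le_choose _ (by omega)
      have h2 : c < (c + 1 + m + 1).choose (m + 1 + 1) := by
        have h3 := Nat.choose_symm_add (a := c) (b := m + 2)
        have h4 : c + 1 ≤ (c + (m + 2)).choose c := by
          calc c + 1 = (c + 1).choose c := by simp
            _ ≤ _ := Nat.choose_le_choose _ (by omega)
        rw [show c + 1 + m + 1 = c + (m + 2) by ring, ← h3]
        omega
      omega)
  exact ⟨J, k, h⟩

open Classical in
/-- `c^{<m>} = ∑_{j=J}^{m} (k j + 1 choose j + 1)`, where `c = ∑_{j=J}^{m} (k j choose j)` is the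
`m`-th Macaulay representation of `c`; in particular `0^{<m>} = 0`.  The representation exists for
every `m ≥ 1`; the value for `m = 0` is a placeholder. -/
noncomputable def macaulayUp (m c : ℕ) : ℕ :=
  if hm : 1 ≤ m then
    ∑ j ∈ Finset.Icc (exists_isMacaulayRep hm c).choose m,
      ((exists_isMacaulayRep hm c).choose_spec.choose j + 1).choose (j + 1)
  else 0

/-- `[[c^{<m>}]^{<m+1>} ⋯]^{<m+d-1>}`, with `d` operations (so it is `c` for `d = 0`). -/
noncomputable def macaulayIter (m c : ℕ) : ℕ → ℕ
  | 0 => c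
  | d + 1 => macaulayUp (m + d) (macaulayIter m c d)

end SquaredNorm

namespace SquaredNorm

/-! Diagonalise the coefficient matrix: r = ∑ λ_i |f_i|², where the f_i form a basis of the forms of
degree m. Let φ be a linear functional on forms of degree m + d. Substituting φ(α) · conj φ(β) for
z^α z̄^β sends a squared norm to a number ≥ 0, and sends r‖z‖^{2d} to a combination, with positive
weights, of the numbers ∑_i λ_i |φ(z^γ f_i)|² with |γ| = d. If φ kills every z^γ f_i with λ_i > 0,
the result is also ≤ 0. Hence it is zero, and φ kills the z^γ f_i with λ_i < 0 as well.

So the annihilator of the P positive forms in degree m + d lies in that of all R forms with λ_i ≠ 0.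
The former is cut out by P · D_d equations, so its dimension is at least D_{m+d} - P D_d. The latter
is dual to the degree m + d part of the quotient by the ideal of the R forms, which has dimension
D_m - R in degree m; Macaulay's theorem, applied d times, bounds its dimension
(`finrank_le_growUp`).

Macaulay's theorem comes from Green's theorem on general hyperplane sections
(`exists_finrank_inf_ker_linComb_le_greenDown`). Both are proved for functionals: multiplication by
variables becomes a family of commuting operators lowering the degree, and restriction to a
hyperplane becomes the kernel of a linear combination of them. The closed form holds because
shifting every k_j and j by one turns a representation of c into one of c^{<m>}. -/

/-! ### Arithmetic of Macaulay representations: Green's and Macaulay's functions. -/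

theorem exists_lt_choose (d c : ℕ) : ∃ k, c < (k + 1).choose (d + 1) := by
  refine ⟨c + d, ?_⟩
  induction d with
  | zero => simp
  | succ d ih =>
    have := Nat.choose_succ_succ' (c + (d + 1)) (d + 1)
    have h : c + (d + 1) = c + d + 1 := by ring
    rw [h] at this ⊢
    omega

/-- The largest `k` with `k.choose (d + 1) ≤ c`. -/
noncomputable def macaulayTop (d c : ℕ) : ℕ := Nat.find (exists_lt_choose d c)

theorem lt_choose_macaulayTop (d c : ℕ) : c < (macaulayTop d c + 1).choose (d + 1) :=
  Nat.find_spec (exists_lt_choose d c)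

theorem choose_macaulayTop_le (d c : ℕ) : (macaulayTop d c).choose (d + 1) ≤ c := by
  rcases h : macaulayTop d c with _ | a
  · simp
  · exact not_lt.1 (Nat.find_min (exists_lt_choose d c) (m := a) (by
      unfold macaulayTop at h; omega))

theorem macaulayTop_eq {d c k : ℕ} (h1 : k.choose (d + 1) ≤ c)
    (h2 : c < (k + 1).choose (d + 1)) : macaulayTop d c = k := by
  have h3 := choose_macaulayTop_le d c
  have h4 := lt_choose_macaulayTop d c
  by_contra hne
  rcases Nat.lt_or_gt_of_ne hne with h | h
  · have := Nat.choose_le_choose (d + 1) (show macaulayTop d c + 1 ≤ k from h)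
    omega
  · have := Nat.choose_le_choose (d + 1) (show k + 1 ≤ macaulayTop d c from h)
    omega

theorem le_macaulayTop (d c : ℕ) : d ≤ macaulayTop d c := by
  by_contra! h
  have := lt_choose_macaulayTop d c
  rw [Nat.choose_eq_zero_of_lt (by omega)] at this
  omega

theorem macaulayTop_add {d k c : ℕ} (hc : c < k.choose d) :
    macaulayTop d (k.choose (d + 1) + c) = k := by
  refine macaulayTop_eq (by omega) ?_
  rw [Nat.choose_succ_succ']
  omega

/-- Splits off the leading binomial. The value k = d is allowed and occurs exactly for c = 0, so
representations are padded with vanishing terms instead of stopping at some J. -/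
theorem exists_eq_choose_add (d c : ℕ) :
    ∃ k c', d ≤ k ∧ c' < k.choose d ∧ c = k.choose (d + 1) + c' := by
  have h1 := lt_choose_macaulayTop d c
  have h2 := choose_macaulayTop_le d c
  rw [Nat.choose_succ_succ'] at h1
  exact ⟨macaulayTop d c, c - (macaulayTop d c).choose (d + 1), le_macaulayTop d c,
    by omega, by omega⟩

/-- Green's function: `greenDown d c = ∑ (k j - 1 choose j)`, where `c = ∑ (k j choose j)` is the
`(d + 1)`-st Macaulay representation of `c`. -/
noncomputable def greenDown : ℕ → ℕ → ℕ
  | 0, c => c - 1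
  | d + 1, c => (macaulayTop (d + 1) c - 1).choose (d + 2) +
      greenDown d (c - (macaulayTop (d + 1) c).choose (d + 2))

/-- Macaulay's function: `growUp d c = ∑ (k j + 1 choose j + 1)`, where `c = ∑ (k j choose j)` is
the `(d + 1)`-st Macaulay representation of `c`. -/
noncomputable def growUp : ℕ → ℕ → ℕ
  | 0, c => (c + 1).choose 2
  | d + 1, c => (macaulayTop (d + 1) c + 1).choose (d + 3) +
      growUp d (c - (macaulayTop (d + 1) c).choose (d + 2))

theorem greenDown_choose_add_of_lt {d k c : ℕ} (hc : c < k.choose (d + 1)) :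
    greenDown (d + 1) (k.choose (d + 2) + c) = (k - 1).choose (d + 2) + greenDown d c := by
  rw [greenDown, macaulayTop_add hc, Nat.add_sub_cancel_left]

theorem growUp_choose_add {d k c : ℕ} (hc : c < k.choose (d + 1)) :
    growUp (d + 1) (k.choose (d + 2) + c) = (k + 1).choose (d + 3) + growUp d c := by
  rw [growUp, macaulayTop_add hc, Nat.add_sub_cancel_left]

theorem greenDown_zero (d : ℕ) : greenDown d 0 = 0 := by
  induction d with
  | zero => rfl
  | succ d ih =>
    have h := greenDown_choose_add_of_lt (d := d) (k := d + 1) (c := 0) (by simp)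
    simpa [ih, Nat.choose_eq_zero_of_lt] using h

theorem growUp_zero (d : ℕ) : growUp d 0 = 0 := by
  induction d with
  | zero => rfl
  | succ d ih =>
    have h := growUp_choose_add (d := d) (k := d + 1) (c := 0) (by simp)
    simpa [ih, Nat.choose_eq_zero_of_lt] using h

theorem greenDown_choose {d k : ℕ} (hk : d + 1 ≤ k) :
    greenDown d (k.choose (d + 1)) = (k - 1).choose (d + 1) := by
  rcases d with _ | d
  · simp [greenDown]
  · have h := greenDown_choose_add_of_lt (d := d) (k := k) (c := 0) (Nat.choose_pos (by omega))
    simpa [greenDown_zero] using h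

/-- The boundary value c = k.choose (d + 1) is not in normal form, but Pascal's rule gives the same
result there. Allowing it lets the remainder grow by one without a change of leading binomial. -/
theorem greenDown_choose_add {d k c : ℕ} (hk : d + 1 ≤ k) (hc : c ≤ k.choose (d + 1)) :
    greenDown (d + 1) (k.choose (d + 2) + c) = (k - 1).choose (d + 2) + greenDown d c := by
  rcases hc.lt_or_eq with h | rfl
  · exact greenDown_choose_add_of_lt h
  · have h1 := Nat.choose_succ_succ' k (d + 1)
    rw [greenDown_choose hk, add_comm (k.choose _), ← h1, greenDown_choose (by omega)]
    obtain ⟨k, rfl⟩ : ∃ l, k = l + 1 := ⟨k - 1, by omega⟩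
    simp only [Nat.add_sub_cancel]
    rw [Nat.choose_succ_succ' k (d + 1), add_comm]

/-- Monotone and 1-Lipschitz: passing from c to c + 1 only changes the remainder, so the claim
descends to degree one. -/
theorem greenDown_succ_bounds (d : ℕ) : ∀ c,
    greenDown d c ≤ greenDown d (c + 1) ∧ greenDown d (c + 1) ≤ greenDown d c + 1 := by
  induction d with
  | zero => intro c; simp only [greenDown]; omega
  | succ d ih =>
    intro c
    obtain ⟨k, c', hk, hc', rfl⟩ := exists_eq_choose_add (d + 1) c
    have e1 := greenDown_choose_add hk hc'.le
    have e2 := greenDown_choose_add (c := c' + 1) hk hc'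
    have := ih c'
    rw [← add_assoc] at e2
    simp only [show d + 1 + 1 = d + 2 from rfl] at *
    omega

theorem greenDown_mono (d : ℕ) : Monotone (greenDown d) :=
  monotone_nat_of_le_succ fun c => (greenDown_succ_bounds d c).1

theorem greenDown_add_le (d a b : ℕ) : greenDown d (a + b) ≤ greenDown d a + b := by
  induction b with
  | zero => simp
  | succ b ih =>
    have := (greenDown_succ_bounds d (a + b)).2
    rw [← add_assoc]
    omega

theorem greenDown_lt {d c : ℕ} (hc : 0 < c) : greenDown d c < c := by
  have h1 : greenDown d 1 = 0 := by
    have h := greenDown_choose (d := d) (k := d + 1) le_rfl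
    simpa [Nat.choose_eq_zero_of_lt] using h
  have h2 := greenDown_add_le d 1 (c - 1)
  rw [show 1 + (c - 1) = c by omega] at h2
  omega

/-- Strictness needs d + 2 ≤ k: for k = d + 1 the right-hand side is zero. -/
theorem greenDown_lt_choose (d : ℕ) : ∀ {k c : ℕ}, d + 2 ≤ k → c < k.choose (d + 1) →
    greenDown d c < (k - 1).choose (d + 1) := by
  induction d with
  | zero => intro k c hk hc; simp [greenDown] at *; omega
  | succ d ih =>
    intro k c hk hc
    obtain ⟨j, c', hj, hc', rfl⟩ := exists_eq_choose_add (d + 1) c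
    have hjk : j < k := by
      by_contra! h
      have := Nat.choose_le_choose (d + 2) h
      simp only [show d + 1 + 1 = d + 2 from rfl] at *
      omega
    rw [greenDown_choose_add hj hc'.le]
    rcases hj.lt_or_eq with h | rfl
    · have h1 := ih h hc'
      obtain ⟨j, rfl⟩ : ∃ l, j = l + 1 := ⟨j - 1, by omega⟩
      have h2 := Nat.choose_le_choose (d + 2) (show j + 1 ≤ k - 1 by omega)
      have h3 := Nat.choose_succ_succ' j (d + 1)
      simp only [Nat.add_sub_cancel, show d + 1 + 1 = d + 2 from rfl] at *
      omega
    · have h0 : c' = 0 := by simpa using hc'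
      subst h0
      rw [greenDown_zero, Nat.choose_eq_zero_of_lt (by omega)]
      exact Nat.choose_pos (by omega)

/-- The numerical step in the proof of Green's restriction theorem, at the critical value. -/
theorem green_numeric_aux (d : ℕ) : ∀ c, greenDown (d + 1) c < c →
    greenDown d (c - (greenDown (d + 1) c + 1)) + greenDown (d + 1) (greenDown (d + 1) c + 1)
      < greenDown (d + 1) c + 1 := by
  induction d with
  | zero =>
    intro c hc
    obtain ⟨k, c₁, hk, hc₁, rfl⟩ := exists_eq_choose_add 1 c
    rcases hk.lt_or_eq with hk' | rfl
    swap
    · have : c₁ = 0 := by simpa using hc₁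
      subst this
      simp at hc
    obtain ⟨k, rfl⟩ : ∃ l, k = l + 2 := ⟨k - 2, by omega⟩
    simp only [Nat.choose_one_right] at hc₁
    have e := greenDown_choose_add (d := 0) (k := k + 2) (c := c₁) (by omega) (by simp; omega)
    have e2 := greenDown_choose_add (d := 0) (k := k + 1) (c := c₁ - 1 + 1) (by omega)
      (by simp; omega)
    have s1 := Nat.choose_succ_succ' (k + 1) 1
    have s2 := Nat.choose_succ_succ' k 1
    simp only [greenDown, zero_add, Nat.add_sub_cancel, Nat.reduceAdd, Nat.choose_one_right,
      show k + 2 - 1 = k + 1 from rfl, show k + 1 + 1 = k + 2 from rfl] at *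
    rw [e, add_assoc, e2]
    omega
  | succ d ih =>
    intro c hc
    obtain ⟨k, c₁, hk, hc₁, rfl⟩ := exists_eq_choose_add (d + 2) c
    rcases hk.lt_or_eq with hk' | rfl
    swap
    · have : c₁ = 0 := by simpa using hc₁
      subst this
      simp at hc
    obtain ⟨k, rfl⟩ : ∃ l, k = l + 2 := ⟨k - 2, by omega⟩
    have e := greenDown_choose_add (d := d + 1) (by omega) hc₁.le
    have hb := greenDown_lt_choose (d + 1) (by omega) hc₁
    have e2 := greenDown_choose_add (d := d + 1) (k := k + 1) (by omega) (Nat.succ_le_of_lt hb)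
    have s1 := Nat.choose_succ_succ' (k + 1) (d + 2)
    have s2 := Nat.choose_succ_succ' k (d + 2)
    have s3 := Nat.choose_succ_succ' (k + 1) (d + 1)
    simp only [Nat.succ_eq_add_one, show k + 2 - 1 = k + 1 from rfl, Nat.add_sub_cancel,
      show k + 1 + 1 = k + 2 from rfl, show d + 1 + 1 = d + 2 from rfl,
      show d + 1 + 2 = d + 3 from rfl] at *
    rw [e, add_assoc, e2]
    -- The leading binomials on the left already add up by Pascal's rule to the leading binomial of
    -- `greenDown`, which reduces the claim to the remainder c₁. Zero remainder is separate, since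
    -- the induction hypothesis needs `greenDown (d + 1) c₁ < c₁`.
    rcases Nat.eq_zero_or_pos c₁ with rfl | hpos
    · rw [greenDown_zero] at *
      have m1 := greenDown_mono (d + 1) (show (k + 2).choose (d + 3) + 0 -
        ((k + 1).choose (d + 3) + (0 + 1)) ≤ (k + 1).choose (d + 2) by omega)
      rw [greenDown_choose (by omega)] at m1
      have := greenDown_lt (d := d + 1) (c := 0 + 1) (by omega)
      simp only [Nat.add_sub_cancel, show d + 1 + 1 = d + 2 from rfl] at *
      omega
    · have hlt := greenDown_lt (d := d + 1) hpos
      have hI := ih c₁ hlt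
      -- The Lipschitz bound between c₁ and (k + 2).choose (d + 2) makes the remainder of the
      -- difference at most (k + 1).choose (d + 1), as `greenDown_choose_add` requires.
      have hf := greenDown_add_le (d + 1) c₁ ((k + 2).choose (d + 2) - c₁)
      rw [show c₁ + ((k + 2).choose (d + 2) - c₁) = (k + 2).choose (d + 2) by omega,
        greenDown_choose (by omega)] at hf
      have e3 := greenDown_choose_add (d := d) (k := k + 1) (c := c₁ - (greenDown (d + 1) c₁ + 1))
        (by omega) (by
          simp only [show d + 1 + 1 = d + 2 from rfl, show k + 2 - 1 = k + 1 from rfl] at *; omega)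
      rw [show (k + 2).choose (d + 3) + c₁ - ((k + 1).choose (d + 3) + (greenDown (d + 1) c₁ + 1))
        = (k + 1).choose (d + 2) + (c₁ - (greenDown (d + 1) c₁ + 1)) by omega, e3]
      simp only [Nat.add_sub_cancel]
      omega

/-- The numerical step in the proof of Green's restriction theorem. -/
theorem le_greenDown_of_le {d c b : ℕ} (hbc : b ≤ c)
    (h : b ≤ greenDown d (c - b) + greenDown (d + 1) b) : b ≤ greenDown (d + 1) c := by
  by_contra! hlt
  have h1 := green_numeric_aux d c (by omega)
  -- As b grows, `b - greenDown (d + 1) b` does not decrease and `greenDown d (c - b)` does not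
  -- increase, so failure at the critical value persists for every larger b.
  have h2 := greenDown_add_le (d + 1) (greenDown (d + 1) c + 1) (b - (greenDown (d + 1) c + 1))
  rw [show greenDown (d + 1) c + 1 + (b - (greenDown (d + 1) c + 1)) = b by omega] at h2
  have h3 := greenDown_mono d (show c - b ≤ c - (greenDown (d + 1) c + 1) by omega)
  omega

theorem growUp_lt_choose (d : ℕ) : ∀ {k c : ℕ}, c < k.choose (d + 1) →
    growUp d c < (k + 1).choose (d + 2) := by
  induction d with
  | zero =>
    intro k c hc
    simp only [zero_add, Nat.choose_one_right] at hc
    have h1 := Nat.choose_le_choose 2 (show c + 2 ≤ k + 1 by omega)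
    have h2 := Nat.choose_succ_succ' (c + 1) 1
    simp only [growUp, zero_add, Nat.choose_one_right, Nat.reduceAdd,
      show c + 1 + 1 = c + 2 from rfl] at *
    omega
  | succ d ih =>
    intro k c hc
    obtain ⟨j, c', hj, hc', rfl⟩ := exists_eq_choose_add (d + 1) c
    have hjk : j < k := by
      by_contra! h
      have := Nat.choose_le_choose (d + 2) h
      simp only [show d + 1 + 1 = d + 2 from rfl] at *
      omega
    rw [growUp_choose_add hc']
    have h1 := ih hc'
    have h2 := Nat.choose_le_choose (d + 3) (show j + 1 + 1 ≤ k + 1 by omega)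
    have h3 := Nat.choose_succ_succ' (j + 1) (d + 2)
    simp only [show d + 1 + 2 = d + 3 from rfl] at *
    omega

theorem growUp_mono (d : ℕ) : Monotone (growUp d) := by
  induction d with
  | zero => intro a b h; exact Nat.choose_le_choose 2 (by omega)
  | succ d ih =>
    intro a b h
    obtain ⟨j, a', hj, ha', rfl⟩ := exists_eq_choose_add (d + 1) a
    obtain ⟨k, b', hk, hb', rfl⟩ := exists_eq_choose_add (d + 1) b
    have h1 := growUp_choose_add ha'
    have h2 := growUp_choose_add hb'
    have h3 := growUp_lt_choose d ha'
    have s := Nat.choose_succ_succ' (j + 1) (d + 2)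
    have t := Nat.choose_succ_succ' k (d + 1)
    simp only [show d + 1 + 1 = d + 2 from rfl, show d + 2 + 1 = d + 3 from rfl] at *
    rw [h1, h2]
    rcases lt_trichotomy j k with hjk | rfl | hjk
    · have := Nat.choose_le_choose (d + 3) (show j + 1 + 1 ≤ k + 1 by omega)
      omega
    · have := ih (show a' ≤ b' by omega)
      omega
    · have := Nat.choose_le_choose (d + 2) (show k + 1 ≤ j by omega)
      omega

/-- The value `growUp d c + 1` violates the inequality e ≤ c + `greenDown (d + 1) e`. Term by term,
(k + 1 choose j + 1) - (k choose j + 1) = (k choose j), and these differences sum to c. -/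
theorem growUp_greenDown (d : ℕ) : ∀ c,
    c + 1 + greenDown (d + 1) (growUp d c + 1) ≤ growUp d c + 1 := by
  induction d with
  | zero =>
    intro c
    have h := greenDown_choose_add (d := 0) (k := c + 1) (c := 1) (by omega) (by simp)
    have s := Nat.choose_succ_succ' c 1
    simp only [growUp, greenDown, zero_add, Nat.add_sub_cancel, Nat.choose_one_right,
      Nat.reduceAdd] at *
    omega
  | succ d ih =>
    intro c
    obtain ⟨k, c₁, hk, hc₁, rfl⟩ := exists_eq_choose_add (d + 1) c
    have h1 := growUp_lt_choose d hc₁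
    have h2 := greenDown_choose_add (d := d + 1) (k := k + 1) (by omega) (Nat.succ_le_of_lt h1)
    have h3 := growUp_choose_add hc₁
    have s := Nat.choose_succ_succ' k (d + 2)
    have hI := ih c₁
    simp only [Nat.succ_eq_add_one, Nat.add_sub_cancel, show d + 1 + 1 = d + 2 from rfl,
      show d + 1 + 2 = d + 3 from rfl] at *
    rw [← add_assoc] at h2
    rw [h3]
    omega

/-- Macaulay's bound follows from Green's bound. -/
theorem le_growUp_of_le {d c e : ℕ} (h : e ≤ c + greenDown (d + 1) e) : e ≤ growUp d c := by
  by_contra! hlt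
  have h1 := growUp_greenDown d c
  -- Since `e - greenDown (d + 1) e` does not decrease with e, the violation at `growUp d c + 1`
  -- carries over to every larger e.
  have h2 := greenDown_add_le (d + 1) (growUp d c + 1) (e - (growUp d c + 1))
  rw [show growUp d c + 1 + (e - (growUp d c + 1)) = e by omega] at h2
  omega

/-! ### Macaulay representations and the recursive functions. -/

theorem IsMacaulayRep.tail {m c J : ℕ} {k : ℕ → ℕ} (h : IsMacaulayRep (m + 1) c J k)
    (hJ : J ≤ m + 1) : IsMacaulayRep m (∑ j ∈ Finset.Icc J m, (k j).choose j) J k :=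
  ⟨h.pos, hJ, fun i j hi hij hj => h.strict i j hi hij (by omega), fun hJ' => h.ge (by omega), rfl⟩

theorem IsMacaulayRep.le_apply {m c J : ℕ} {k : ℕ → ℕ} (h : IsMacaulayRep m c J k) (i : ℕ)
    (hi : J + i ≤ m) : J + i ≤ k (J + i) := by
  induction i with
  | zero => exact h.ge hi
  | succ i ihi =>
    have h2 := h.strict (J + i) (J + (i + 1)) (by omega) (by omega) hi
    have h3 := ihi (by omega)
    omega

/-- By Pascal's rule and induction on the tail, a representation with top below b stays below
b.choose m. This makes the greedy choice of leading term the only one; m ≤ b is needed for the empty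
representation. -/
theorem IsMacaulayRep.lt_choose {m : ℕ} : ∀ {c J b : ℕ} {k : ℕ → ℕ}, IsMacaulayRep m c J k →
    m ≤ b → (J ≤ m → k m < b) → c < b.choose m := by
  induction m with
  | zero =>
    intro c J b k h _ _
    have := h.pos
    rw [h.sum, Finset.Icc_eq_empty (by omega)]
    simp
  | succ m ih =>
    intro c J b k h hb hk
    rcases Nat.lt_or_ge (m + 1) J with hJ | hJ
    · rw [h.sum, Finset.Icc_eq_empty (by omega)]
      exact Nat.choose_pos hb
    · have h1 : m ≤ k (m + 1) := by
        have := h.le_apply (m + 1 - J) (by omega)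
        rw [show J + (m + 1 - J) = m + 1 by omega] at this
        omega
      have h2 := ih (h.tail hJ) h1 (fun hJm => h.strict m (m + 1) hJm (by omega) le_rfl)
      have h3 := Nat.choose_le_choose (m + 1) (show k (m + 1) + 1 ≤ b from hk hJ)
      have h4 := Nat.choose_succ_succ' (k (m + 1)) m
      have h5 := h.sum
      rw [Finset.sum_Icc_succ_top hJ] at h5
      omega

/-- Every representation agrees with the greedy recursion, so the arbitrary choice made in
`macaulayUp` does not matter. -/
theorem IsMacaulayRep.sum_eq_growUp {d : ℕ} : ∀ {c J : ℕ} {k : ℕ → ℕ},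
    IsMacaulayRep (d + 1) c J k →
      ∑ j ∈ Finset.Icc J (d + 1), (k j + 1).choose (j + 1) = growUp d c := by
  induction d with
  | zero =>
    intro c J k h
    have h1 := h.pos
    have h2 := h.le
    have h3 := h.sum
    rcases Nat.lt_or_ge 1 J with hJ | hJ
    · rw [Finset.Icc_eq_empty (by omega)] at h3 ⊢
      simp at h3
      simp [h3, growUp]
    · obtain rfl : J = 1 := by omega
      simp at h3
      simp [h3, growUp]
  | succ d ih =>
    intro c J k h
    rcases Nat.lt_or_ge (d + 2) J with hJ | hJ
    · have h3 := h.sum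
      rw [Finset.Icc_eq_empty (by omega)] at h3 ⊢
      simp at h3
      rw [h3, growUp_zero, Finset.sum_empty]
    · have h1 := h.tail hJ
      have h2 := h.le_apply (d + 2 - J) (by omega)
      rw [show J + (d + 2 - J) = d + 2 by omega] at h2
      have h3 := h1.lt_choose (show d + 1 ≤ k (d + 2) by omega)
        (fun hJm => h.strict (d + 1) (d + 2) hJm (by omega) le_rfl)
      have h4 := h.sum
      rw [Finset.sum_Icc_succ_top hJ] at h4 ⊢
      rw [ih h1, h4, add_comm _ ((k (d + 1 + 1)).choose _), growUp_choose_add h3, add_comm]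

theorem macaulayUp_eq_growUp (d c : ℕ) : macaulayUp (d + 1) c = growUp d c := by
  have h : 1 ≤ d + 1 := by omega
  rw [macaulayUp, dif_pos h]
  exact (exists_isMacaulayRep h c).choose_spec.choose_spec.sum_eq_growUp

theorem sum_Icc_add_right {M : Type*} [AddCommMonoid M] (f : ℕ → M) (a b d : ℕ) :
    ∑ j ∈ Finset.Icc (a + d) (b + d), f j = ∑ j ∈ Finset.Icc a b, f (j + d) := by
  rw [← Finset.map_add_right_Icc, Finset.sum_map]
  rfl

/-- The shifted sequence is still strictly increasing and its sum is c^{<m>} by definition, so it is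
a representation ready for the next operation. -/
theorem IsMacaulayRep.succ {m c J : ℕ} {k : ℕ → ℕ} (hm : 1 ≤ m)
    (h : IsMacaulayRep m c J k) :
    IsMacaulayRep (m + 1) (macaulayUp m c) (J + 1) (fun j => k (j - 1) + 1) where
  pos := by omega
  le := by have := h.le; omega
  strict i j hi hij hj := by
    have := h.strict (i - 1) (j - 1) (by omega) (by omega) (by omega)
    omega
  ge hJ := by simpa using h.ge (by omega)
  sum := by
    obtain ⟨m, rfl⟩ : ∃ l, m = l + 1 := ⟨m - 1, by omega⟩
    rw [macaulayUp_eq_growUp, ← h.sum_eq_growUp, sum_Icc_add_right]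
    rfl

theorem IsMacaulayRep.iter {m c J : ℕ} {k : ℕ → ℕ} (hm : 1 ≤ m)
    (h : IsMacaulayRep m c J k) (d : ℕ) :
    IsMacaulayRep (m + d) (macaulayIter m c d) (J + d) (fun j => k (j - d) + d) := by
  induction d with
  | zero => exact h
  | succ d ih =>
    have := ih.succ (by omega)
    simp only [Nat.sub_sub, add_comm 1 d] at this
    exact this

theorem macaulayIter_eq_sum {m c J : ℕ} {k : ℕ → ℕ} (hm : 1 ≤ m)
    (h : IsMacaulayRep m c J k) (d : ℕ) :
    macaulayIter m c d = ∑ j ∈ Finset.Icc J m, (k j + d).choose (j + d) := by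
  rw [(h.iter hm d).sum, sum_Icc_add_right]
  simp only [Nat.add_sub_cancel]

/-! ### Green's and Macaulay's theorems for commuting operators. -/

open Module

section Green

theorem exists_eval_ne_zero {K ι : Type*} [Field K] [Infinite K] {p : MvPolynomial ι K} (hp : p ≠ 0) :
    ∃ w, eval w p ≠ 0 := by
  by_contra! h
  exact hp (MvPolynomial.funext fun w => by rw [h w, map_zero])

variable {K E ι : Type*} [Field K] [AddCommGroup E] [Module K E] [Fintype ι]

theorem finrank_inf_ker_add_finrank_map (U : Submodule K E) [FiniteDimensional K U]
    (f : E →ₗ[K] E) :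
    finrank K ↥(U ⊓ LinearMap.ker f) + finrank K ↥(U.map f) = finrank K U := by
  have h := (f.domRestrict U).finrank_range_add_finrank_ker
  rw [LinearMap.range_domRestrict, LinearMap.ker_domRestrict] at h
  rw [← h, add_comm, ← Submodule.map_comap_subtype, Submodule.finrank_map_subtype_eq]

/-- The linear combination of the operators `T i` with coefficients `v i`. -/
def linComb (T : ι → E →ₗ[K] E) (v : ι → K) : E →ₗ[K] E := ∑ i, v i • T i

theorem linComb_apply (T : ι → E →ₗ[K] E) (v : ι → K) (x : E) :
    linComb T v x = ∑ i, v i • T i x := by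
  simp [linComb]

theorem linComb_comm {T : ι → E →ₗ[K] E} (hT : ∀ i j x, T i (T j x) = T j (T i x))
    (v w : ι → K) (x : E) : linComb T v (linComb T w x) = linComb T w (linComb T v x) := by
  simp only [linComb_apply, map_sum, map_smul, Finset.smul_sum]
  rw [Finset.sum_comm]
  refine Finset.sum_congr rfl fun i _ => Finset.sum_congr rfl fun j _ => ?_
  rw [hT, smul_comm]

/-- The dimension of the kernel of a linear combination is upper semicontinuous in the
coefficients. -/
theorem exists_finrank_inf_ker_linComb_le (T : ι → E →ₗ[K] E) (U : Submodule K E)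
    [FiniteDimensional K U] (v : ι → K) :
    ∃ p : MvPolynomial ι K, p ≠ 0 ∧ ∀ w, eval w p ≠ 0 →
      finrank K ↥(U ⊓ LinearMap.ker (linComb T w)) ≤
        finrank K ↥(U ⊓ LinearMap.ker (linComb T v)) := by
  -- Lift a basis of the image under v to vectors u j of U and extend the coordinate functionals to
  -- φ i. The determinant of φ i (T_w (u j)) is a polynomial in w with value 1 at v; where it is
  -- nonzero, the vectors T_w (u j) are independent, so the rank has not dropped.
  let b := finBasis K (U.map (linComb T v))
  have hb : ∀ j, ∃ u ∈ U, linComb T v u = b j := fun j => (b j).2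
  choose u hu hub using hb
  have hφ : ∀ i, ∃ φ : E →ₗ[K] K, φ.comp (U.map (linComb T v)).subtype = b.coord i :=
    fun i => (b.coord i).exists_extend
  choose φ hφ using hφ
  have hev : ∀ w, eval w (Matrix.det (Matrix.of fun i j =>
      ∑ k, C (φ i (T k (u j))) * X k : Matrix _ _ (MvPolynomial ι K))) =
        Matrix.det (Matrix.of fun i j => φ i (linComb T w (u j))) := by
    intro w
    rw [RingHom.map_det]
    congr 1
    ext i j
    simp [linComb_apply, mul_comm]
  refine ⟨Matrix.det (Matrix.of fun i j => ∑ k, C (φ i (T k (u j))) * X k), ?_, ?_⟩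
  · intro h0
    have h1 := hev v
    rw [h0, map_zero] at h1
    have h2 : (Matrix.of fun i j => φ i (linComb T v (u j))) = (1 : Matrix _ _ K) := by
      ext i j
      have := LinearMap.congr_fun (hφ i) (b j)
      simp only [LinearMap.comp_apply, Submodule.subtype_apply, Basis.coord_apply,
        Basis.repr_self] at this
      rw [Matrix.of_apply, hub, this, Matrix.one_apply, Finsupp.single_apply]
      simp only [eq_comm]
    rw [h2, Matrix.det_one] at h1
    exact zero_ne_one h1
  · intro w hw
    rw [hev w] at hw
    have h1 := Matrix.linearIndependent_cols_of_det_ne_zero hw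
    have h2 : LinearIndependent K (fun j => linComb T w (u j)) :=
      LinearIndependent.of_comp (LinearMap.pi φ) h1
    have h3 : LinearIndependent K (fun j => (⟨linComb T w (u j), u j, hu j, rfl⟩ :
        ↥(U.map (linComb T w)))) :=
      LinearIndependent.of_comp (Submodule.subtype _) h2
    have h4 := h3.fintype_card_le_finrank
    rw [Fintype.card_fin] at h4
    have h5 := finrank_inf_ker_add_finrank_map U (linComb T v)
    have h6 := finrank_inf_ker_add_finrank_map U (linComb T w)
    omega

theorem exists_finrank_inf_ker_linComb_lt {T : ι → E →ₗ[K] E} {U : Submodule K E}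
    [FiniteDimensional K U] (hU : U ≠ ⊥) (hker : ∀ x ∈ U, (∀ i, T i x = 0) → x = 0) :
    ∃ v, finrank K ↥(U ⊓ LinearMap.ker (linComb T v)) < finrank K U := by
  classical
  obtain ⟨x, hx, hx0⟩ := Submodule.exists_mem_ne_zero_of_ne_bot hU
  obtain ⟨i, hi⟩ : ∃ i, T i x ≠ 0 := by
    by_contra! h
    exact hx0 (hker x hx h)
  refine ⟨Pi.single i 1, Submodule.finrank_lt_finrank_of_lt (inf_le_left.lt_of_ne fun h => hi ?_)⟩
  have h1 : x ∈ LinearMap.ker (linComb T (Pi.single i 1)) := (h.ge hx).2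
  rw [LinearMap.mem_ker, linComb_apply, Finset.sum_eq_single i] at h1
  · simpa using h1
  · intro j _ hj
    simp [hj]
  · simp

/-- **Green's restriction theorem**, in dual form: for commuting operators of degree `-1` without
common kernel in positive degrees, the kernel of a general linear combination on a subspace of
dimension `c` in degree `d + 1` has dimension at most `c_{<d + 1>}`. -/
theorem exists_finrank_inf_ker_linComb_le_greenDown [Infinite K] {T : ι → E →ₗ[K] E}
    (hT : ∀ i j x, T i (T j x) = T j (T i x)) {M : ℕ → Submodule K E}
    (hM : ∀ d i, ∀ x ∈ M (d + 1), T i x ∈ M d)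
    (hker : ∀ d, ∀ x ∈ M (d + 1), (∀ i, T i x = 0) → x = 0) (d : ℕ) :
    ∀ (c : ℕ) (U : Submodule K E) [FiniteDimensional K U], U ≤ M (d + 1) → finrank K U = c →
      ∃ p : MvPolynomial ι K, p ≠ 0 ∧ ∀ v, eval v p ≠ 0 →
        finrank K ↥(U ⊓ LinearMap.ker (linComb T v)) ≤ greenDown d c := by
  induction d with
  | zero =>
    intro c U _ hU hc
    rcases eq_or_ne U ⊥ with rfl | hne
    · refine ⟨1, one_ne_zero, fun v _ => ?_⟩
      rw [bot_inf_eq, finrank_bot]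
      exact Nat.zero_le _
    · obtain ⟨v, hv⟩ := exists_finrank_inf_ker_linComb_lt hne fun x hx => hker 0 x (hU hx)
      obtain ⟨p, hp, hpv⟩ := exists_finrank_inf_ker_linComb_le T U v
      refine ⟨p, hp, fun w hw => ?_⟩
      have := hpv w hw
      rw [greenDown]
      omega
  | succ d ihd =>
    intro c
    induction c using Nat.strong_induction_on with
    | _ c ihc =>
    intro U _ hU hc
    rcases eq_or_ne U ⊥ with rfl | hne
    · refine ⟨1, one_ne_zero, fun v _ => ?_⟩
      rw [bot_inf_eq, finrank_bot]
      exact Nat.zero_le _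
    obtain ⟨v₀, hv₀⟩ := exists_finrank_inf_ker_linComb_lt hne fun x hx => hker _ x (hU hx)
    -- Choose v with the smallest kernel. By semicontinuity it suffices to bound that minimum b = g
    -- v.
    let g : (ι → K) → ℕ := fun v => finrank K ↥(U ⊓ LinearMap.ker (linComb T v))
    obtain ⟨v, hv⟩ : ∃ v, ∀ w, g v ≤ g w := by
      obtain ⟨v, hv⟩ := Nat.sInf_mem (Set.range_nonempty g)
      exact ⟨v, fun w => hv ▸ Nat.sInf_le ⟨w, rfl⟩⟩
    have hlt : g v < c := hc ▸ (hv v₀).trans_lt hv₀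
    have hfr := finrank_inf_ker_add_finrank_map U (linComb T v)
    have hmap : U.map (linComb T v) ≤ M (d + 1) := by
      rintro _ ⟨x, hx, rfl⟩
      rw [linComb_apply]
      exact Submodule.sum_mem _ fun i _ => Submodule.smul_mem _ _ (hM _ i x (hU hx))
    obtain ⟨p₁, hp₁, h₁⟩ := ihd (c - g v) (U.map (linComb T v)) hmap
      (by change g v + _ = _ at hfr; omega)
    obtain ⟨p₂, hp₂, h₂⟩ := ihc (g v) hlt (U ⊓ LinearMap.ker (linComb T v))
      (inf_le_left.trans hU) rfl
    obtain ⟨p₃, hp₃, h₃⟩ := exists_finrank_inf_ker_linComb_le T U v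
    refine ⟨p₃, hp₃, fun w hw => (h₃ w hw).trans ?_⟩
    -- For general w, apply rank-nullity to T_v on U ∩ ker T_w. The kernel is bounded by the
    -- induction on dimension, and the image, which lies in T_v U ∩ ker T_w by commutation, by the
    -- induction on degree. Minimality makes the total at least b, hence b ≤ `greenDown d (c - b) +
    -- greenDown (d + 1) b`.
    obtain ⟨w, hw⟩ := exists_eval_ne_zero (mul_ne_zero hp₁ hp₂)
    rw [map_mul] at hw
    have hw₁ := h₁ w (left_ne_zero_of_mul hw)
    have hw₂ := h₂ w (right_ne_zero_of_mul hw)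
    have hs := finrank_inf_ker_add_finrank_map (U ⊓ LinearMap.ker (linComb T w)) (linComb T v)
    have hle : (U ⊓ LinearMap.ker (linComb T w)).map (linComb T v) ≤
        U.map (linComb T v) ⊓ LinearMap.ker (linComb T w) := by
      rintro _ ⟨x, hx, rfl⟩
      refine ⟨⟨x, hx.1, rfl⟩, ?_⟩
      have h0 : linComb T w x = 0 := hx.2
      change linComb T w (linComb T v x) = 0
      rw [linComb_comm hT, h0, map_zero]
    have hle' := Submodule.finrank_mono hle
    rw [inf_right_comm] at hs
    have hgw : g v ≤ finrank K ↥(U ⊓ LinearMap.ker (linComb T w)) := hv w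
    change g v ≤ _
    exact le_greenDown_of_le hlt.le (by omega)

/-- **Macaulay's theorem** on the growth of Hilbert functions, in dual form. -/
theorem finrank_le_growUp [Infinite K] {T : ι → E →ₗ[K] E}
    (hT : ∀ i j x, T i (T j x) = T j (T i x)) {M : ℕ → Submodule K E}
    (hM : ∀ d i, ∀ x ∈ M (d + 1), T i x ∈ M d)
    (hker : ∀ d, ∀ x ∈ M (d + 1), (∀ i, T i x = 0) → x = 0) {d : ℕ}
    {U V : Submodule K E} [FiniteDimensional K U] [FiniteDimensional K V] (hU : U ≤ M (d + 2))
    (hUV : ∀ i, ∀ x ∈ U, T i x ∈ V) : finrank K U ≤ growUp d (finrank K V) := by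
  obtain ⟨p, hp, h⟩ := exists_finrank_inf_ker_linComb_le_greenDown hT hM hker (d + 1) _ U hU rfl
  obtain ⟨v, hv⟩ := exists_eval_ne_zero hp
  have h1 := h v hv
  have h2 := finrank_inf_ker_add_finrank_map U (linComb T v)
  have h3 : U.map (linComb T v) ≤ V := by
    rintro _ ⟨x, hx, rfl⟩
    rw [linComb_apply]
    exact Submodule.sum_mem _ fun i _ => Submodule.smul_mem _ _ (hUV i x hx)
  have h4 := Submodule.finrank_mono h3
  -- Rank-nullity for a general v gives e ≤ dim V + `greenDown (d + 1) e` with e = dim U.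
  exact le_growUp_of_le (by omega)

end Green

/-! ### Functionals on polynomials and annihilators of ideals. -/

section Shift

variable {n : ℕ}

theorem mem_finsuppAntidiag_univ_iff {k : ℕ} {α : Fin n →₀ ℕ} :
    α ∈ Finset.finsuppAntidiag Finset.univ k ↔ α.degree = k := by
  rw [Finset.mem_finsuppAntidiag, Finsupp.degree_eq_sum]
  simp

theorem card_multiIndex (n k : ℕ) : Fintype.card (MultiIndex n k) = polyDim n k := by
  rw [Fintype.card_coe, Finset.card_finsuppAntidiag_nat_eq_choose, Finset.card_fin, polyDim,
    add_comm]

theorem exists_eq_add_single {d : ℕ} {α : Fin n →₀ ℕ} (h : α.degree = d + 1) :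
    ∃ β i, β.degree = d ∧ α = β + Finsupp.single i 1 := by
  obtain ⟨i, hi⟩ : ∃ i, α i ≠ 0 := by
    by_contra! h0
    rw [Finsupp.degree_eq_sum, Finset.sum_eq_zero fun i _ => h0 i] at h
    omega
  have h1 : α = (α - Finsupp.single i 1) + Finsupp.single i 1 := by
    rw [tsub_add_cancel_of_le]
    rw [Finsupp.single_le_iff]
    omega
  refine ⟨α - Finsupp.single i 1, i, ?_, h1⟩
  rw [h1, map_add, Finsupp.degree_single] at h
  omega

/-- A function on multi-indices is a linear functional on polynomials; `shift γ` is the transpose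
of multiplication by the monomial with exponent `γ`. -/
noncomputable def shift (γ : Fin n →₀ ℕ) : ((Fin n →₀ ℕ) → ℂ) →ₗ[ℂ] ((Fin n →₀ ℕ) → ℂ) :=
  LinearMap.funLeft ℂ ℂ (· + γ)

@[simp]
theorem shift_apply (γ : Fin n →₀ ℕ) (φ : (Fin n →₀ ℕ) → ℂ) (α : Fin n →₀ ℕ) :
    shift γ φ α = φ (α + γ) := rfl

theorem shift_shift (γ δ : Fin n →₀ ℕ) (φ : (Fin n →₀ ℕ) → ℂ) :
    shift γ (shift δ φ) = shift (γ + δ) φ := by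
  ext α
  simp [add_assoc]

theorem shift_zero (φ : (Fin n →₀ ℕ) → ℂ) : shift 0 φ = φ := by
  ext α
  simp

/-- The functions on multi-indices that are supported on multi-indices of degree `k`. -/
def homFun (n k : ℕ) : Submodule ℂ ((Fin n →₀ ℕ) → ℂ) where
  carrier := {φ | ∀ α, α.degree ≠ k → φ α = 0}
  add_mem' hφ hψ α hα := by simp [hφ α hα, hψ α hα]
  zero_mem' := by simp
  smul_mem' c φ hφ α hα := by simp [hφ α hα]

theorem mem_homFun {k : ℕ} {φ : (Fin n →₀ ℕ) → ℂ} :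
    φ ∈ homFun n k ↔ ∀ α, α.degree ≠ k → φ α = 0 := Iff.rfl

/-- A function supported in degree `k` is determined by its values there. -/
noncomputable def homFunEquiv (n k : ℕ) : homFun n k ≃ₗ[ℂ] (MultiIndex n k → ℂ) :=
  LinearEquiv.ofBijective
    ((LinearMap.funLeft ℂ ℂ fun α : MultiIndex n k => α.1).comp (homFun n k).subtype) (by
      refine ⟨(injective_iff_map_eq_zero _).2 fun φ hφ => ?_, fun f => ?_⟩
      · ext α
        by_cases hα : α.degree = k
        · exact congrFun hφ ⟨α, mem_finsuppAntidiag_univ_iff.2 hα⟩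
        · exact φ.2 α hα
      · classical
        refine ⟨⟨fun α => if h : α ∈ Finset.finsuppAntidiag Finset.univ k then f ⟨α, h⟩ else 0,
          fun α hα => ?_⟩, ?_⟩
        · exact dif_neg (mt mem_finsuppAntidiag_univ_iff.1 hα)
        · ext α
          simp only [LinearMap.comp_apply, Submodule.subtype_apply, LinearMap.funLeft_apply]
          rw [dif_pos α.2])

instance (n k : ℕ) : FiniteDimensional ℂ (homFun n k) :=
  (homFunEquiv n k).symm.finiteDimensional

theorem finrank_homFun (n k : ℕ) : finrank ℂ (homFun n k) = polyDim n k := by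
  rw [(homFunEquiv n k).finrank_eq, finrank_fintype_fun_eq_card, card_multiIndex]

theorem shift_mem_homFun {j k : ℕ} {γ : Fin n →₀ ℕ} (hγ : γ.degree = j)
    {φ : (Fin n →₀ ℕ) → ℂ} (hφ : φ ∈ homFun n (k + j)) : shift γ φ ∈ homFun n k := by
  intro α hα
  refine hφ _ ?_
  rw [map_add, hγ]
  omega

/-- Every monomial of positive degree is divisible by a variable. This is the absence of a common
kernel required by Green's theorem. -/
theorem eq_zero_of_shift_single {k : ℕ} {φ : (Fin n →₀ ℕ) → ℂ} (hφ : φ ∈ homFun n (k + 1))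
    (h : ∀ i, shift (Finsupp.single i 1) φ = 0) : φ = 0 := by
  ext α
  by_cases hα : α.degree = k + 1
  · obtain ⟨β, i, -, rfl⟩ := exists_eq_add_single hα
    exact congrFun (h i) β
  · exact hφ α hα

/-- The functional on functions of multi-indices with coefficients `u`. -/
noncomputable def pairing {m : ℕ} (u : MultiIndex n m → ℂ) : ((Fin n →₀ ℕ) → ℂ) →ₗ[ℂ] ℂ :=
  ∑ α, u α • LinearMap.proj α.1

theorem pairing_apply {m : ℕ} (u : MultiIndex n m → ℂ) (φ : (Fin n →₀ ℕ) → ℂ) :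
    pairing u φ = ∑ α, u α * φ α.1 := by
  simp [pairing]

/-- The functionals in degree `m + j` that vanish on the products of the polynomials with
coefficients `u i`, `i ∈ s`, and the monomials of degree `j`. -/
noncomputable def annihilator {m : ℕ} {ι : Type*} (u : ι → MultiIndex n m → ℂ) (s : Set ι)
    (j : ℕ) : Submodule ℂ ((Fin n →₀ ℕ) → ℂ) :=
  homFun n (m + j) ⊓ ⨅ (γ : MultiIndex n j) (i : s), LinearMap.ker (pairing (u i) ∘ₗ shift γ.1)

theorem mem_annihilator {m j : ℕ} {ι : Type*} {u : ι → MultiIndex n m → ℂ} {s : Set ι}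
    {φ : (Fin n →₀ ℕ) → ℂ} : φ ∈ annihilator u s j ↔ φ ∈ homFun n (m + j) ∧
      ∀ γ : Fin n →₀ ℕ, γ.degree = j → ∀ i ∈ s, pairing (u i) (shift γ φ) = 0 := by
  simp only [annihilator, Submodule.mem_inf, Submodule.mem_iInf, LinearMap.mem_ker,
    LinearMap.comp_apply, Subtype.forall, mem_finsuppAntidiag_univ_iff]

theorem annihilator_le_homFun {m j : ℕ} {ι : Type*} (u : ι → MultiIndex n m → ℂ) (s : Set ι) :
    annihilator u s j ≤ homFun n (m + j) := inf_le_left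

instance {m j : ℕ} {ι : Type*} (u : ι → MultiIndex n m → ℂ) (s : Set ι) :
    FiniteDimensional ℂ (annihilator u s j) :=
  Submodule.finiteDimensional_of_le (annihilator_le_homFun u s)

theorem shift_mem_annihilator {m j : ℕ} {ι : Type*} {u : ι → MultiIndex n m → ℂ} {s : Set ι}
    {φ : (Fin n →₀ ℕ) → ℂ} (hφ : φ ∈ annihilator u s (j + 1)) (i : Fin n) :
    shift (Finsupp.single i 1) φ ∈ annihilator u s j := by
  rw [mem_annihilator] at hφ ⊢
  refine ⟨shift_mem_homFun (Finsupp.degree_single _ _) hφ.1, fun γ hγ l hl => ?_⟩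
  rw [shift_shift]
  exact hφ.2 _ (by rw [map_add, hγ, Finsupp.degree_single]) l hl

/-- Each pair of a generator and a monomial of degree j imposes one linear equation. -/
theorem polyDim_le_finrank_annihilator_add {m : ℕ} {ι : Type*} [Finite ι]
    (u : ι → MultiIndex n m → ℂ) (s : Set ι) (j : ℕ) :
    polyDim n (m + j) ≤ finrank ℂ (annihilator u s j) + Nat.card s * polyDim n j := by
  classical
  have := Fintype.ofFinite s
  let f : homFun n (m + j) →ₗ[ℂ] (s × MultiIndex n j → ℂ) :=
    LinearMap.pi fun p => (pairing (u p.1) ∘ₗ shift p.2.1) ∘ₗ (homFun n (m + j)).subtype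
  have h1 := f.finrank_range_add_finrank_ker
  have h2 : finrank ℂ (LinearMap.range f) ≤ Nat.card s * polyDim n j := by
    refine (Submodule.finrank_le _).trans ?_
    rw [finrank_fintype_fun_eq_card, Fintype.card_prod, card_multiIndex, Nat.card_eq_fintype_card]
  have h3 : (LinearMap.ker f).map (homFun n (m + j)).subtype ≤ annihilator u s j := by
    rintro _ ⟨φ, hφ, rfl⟩
    refine mem_annihilator.2 ⟨φ.2, fun γ hγ i hi => ?_⟩
    exact congrFun hφ (⟨i, hi⟩, ⟨γ, mem_finsuppAntidiag_univ_iff.2 hγ⟩)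
  have h4 := Submodule.finrank_mono h3
  rw [Submodule.finrank_map_subtype_eq] at h4
  rw [finrank_homFun] at h1
  omega

/-- When the u i jointly separate functionals of degree m, an element of the annihilator is
determined by its pairings with the u i outside s. -/
theorem finrank_annihilator_zero_add_le {m : ℕ} {u : MultiIndex n m → MultiIndex n m → ℂ}
    (hu : ∀ φ, (∀ i, pairing (u i) φ = 0) → ∀ α : MultiIndex n m, φ α.1 = 0)
    (s : Set (MultiIndex n m)) :
    finrank ℂ (annihilator u s 0) + Nat.card s ≤ polyDim n m := by
  classical
  let f : annihilator u s 0 →ₗ[ℂ] (↥sᶜ → ℂ) :=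
    LinearMap.pi fun i => pairing (u i) ∘ₗ (annihilator u s 0).subtype
  have hf : Function.Injective f := by
    refine (injective_iff_map_eq_zero f).2 fun φ hφ => ?_
    obtain ⟨h1, h2⟩ := mem_annihilator.1 φ.2
    have h3 : ∀ i, pairing (u i) φ.1 = 0 := by
      intro i
      by_cases hi : i ∈ s
      · simpa [shift_zero] using h2 0 (map_zero _) i hi
      · exact congrFun hφ ⟨i, hi⟩
    ext α
    by_cases hα : α.degree = m
    · exact hu _ h3 ⟨α, mem_finsuppAntidiag_univ_iff.2 hα⟩
    · exact h1 α hα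
  have h := LinearMap.finrank_le_finrank_of_injective hf
  have h4 := Fintype.card_compl_set s
  have h5 : Fintype.card s ≤ Fintype.card (MultiIndex n m) := set_fintype_card_le_univ s
  rw [finrank_fintype_fun_eq_card, h4, card_multiIndex] at h
  rw [card_multiIndex] at h5
  rw [Nat.card_eq_fintype_card]
  omega

/-- Shifts carry each annihilator into the preceding one, so Macaulay's theorem applies once per
degree; monotonicity of `growUp` lets the bounds compose. -/
theorem finrank_annihilator_le_macaulayIter {m : ℕ} (hm : 1 ≤ m) {ι : Type*}
    {u : ι → MultiIndex n m → ℂ} {s : Set ι} {c : ℕ}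
    (hc : finrank ℂ (annihilator u s 0) ≤ c) (d : ℕ) :
    finrank ℂ (annihilator u s d) ≤ macaulayIter m c d := by
  induction d with
  | zero => exact hc
  | succ d ih =>
    obtain ⟨l, hl⟩ : ∃ l, m + d = l + 1 := ⟨m + d - 1, by omega⟩
    rw [macaulayIter, hl, macaulayUp_eq_growUp]
    refine le_trans ?_ (growUp_mono l ih)
    refine finrank_le_growUp (T := fun i : Fin n => shift (Finsupp.single i 1))
      (M := homFun n) (fun i j φ => ?_) (fun k i φ hφ => ?_) (fun k φ hφ => ?_) ?_ ?_
    · rw [shift_shift, shift_shift, add_comm]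
    · exact shift_mem_homFun (Finsupp.degree_single _ _) hφ
    · exact eq_zero_of_shift_single hφ
    · rw [show l + 2 = m + (d + 1) by omega]
      exact annihilator_le_homFun u s
    · exact fun i φ hφ => shift_mem_annihilator hφ i

end Shift

/-! ### The Hermitian form of a polynomial, evaluated at a functional. -/

section Hermitian

variable {n : ℕ}

/-- The linear extension of `z ^ α * z̄ ^ β ↦ φ α * conj (φ β)`. -/
noncomputable def hermitianEval (φ : (Fin n →₀ ℕ) → ℂ) :
    MvPolynomial (Fin n ⊕ Fin n) ℂ →ₗ[ℂ] ℂ :=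
  (basisMonomials (Fin n ⊕ Fin n) ℂ).constr ℂ fun s =>
    φ (s.comapDomain Sum.inl Sum.inl_injective.injOn) *
      (starRingEnd ℂ) (φ (s.comapDomain Sum.inr Sum.inr_injective.injOn))

theorem hermitianEval_monomial (φ : (Fin n →₀ ℕ) → ℂ) (s : Fin n ⊕ Fin n →₀ ℕ) (a : ℂ) :
    hermitianEval φ (monomial s a) =
      a * (φ (s.comapDomain Sum.inl Sum.inl_injective.injOn) *
        (starRingEnd ℂ) (φ (s.comapDomain Sum.inr Sum.inr_injective.injOn))) := by
  have h := (basisMonomials (Fin n ⊕ Fin n) ℂ).constr_basis ℂ (fun s =>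
    φ (s.comapDomain Sum.inl Sum.inl_injective.injOn) *
      (starRingEnd ℂ) (φ (s.comapDomain Sum.inr Sum.inr_injective.injOn))) s
  rw [coe_basisMonomials] at h
  rw [← h, show monomial s a = a • monomial s (1 : ℂ) by rw [smul_monomial, smul_eq_mul, mul_one],
    map_smul, smul_eq_mul]
  rfl

/-- The polynomial `‖z‖ ^ 2 = ∑ z i * conj (z i)`. -/
noncomputable def normSqPoly (n : ℕ) : MvPolynomial (Fin n ⊕ Fin n) ℂ :=
  ∑ i, X (Sum.inl i) * X (Sum.inr i)

/-- Multiplication by z_i z̄_i is dual to shifting φ in both of its occurrences. -/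
theorem hermitianEval_mul_normSqPoly (φ : (Fin n →₀ ℕ) → ℂ)
    (p : MvPolynomial (Fin n ⊕ Fin n) ℂ) :
    hermitianEval φ (p * normSqPoly n) =
      ∑ i, hermitianEval (shift (Finsupp.single i 1) φ) p := by
  induction p using MvPolynomial.induction_on' with
  | monomial s a =>
    rw [normSqPoly, Finset.mul_sum, map_sum]
    refine Finset.sum_congr rfl fun i _ => ?_
    rw [X, X, monomial_mul, monomial_mul, hermitianEval_monomial, hermitianEval_monomial,
      mul_one, mul_one, shift_apply, shift_apply]
    congr 4
    · ext j
      simp [Finsupp.single_apply]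
    · ext j
      simp [Finsupp.single_apply]
  | add p q hp hq =>
    rw [add_mul, map_add, hp, hq, ← Finset.sum_add_distrib]
    simp

theorem hermitianEval_rename_mul (φ : (Fin n →₀ ℕ) → ℂ) (h : MvPolynomial (Fin n) ℂ) :
    hermitianEval φ (rename Sum.inl h * rename Sum.inr (map (starRingEnd ℂ) h)) =
      ((‖∑ α ∈ h.support, h.coeff α * φ α‖ ^ 2 : ℝ) : ℂ) := by
  conv_lhs => rw [h.as_sum]
  rw [map_sum, map_sum, map_sum, Finset.sum_mul_sum, map_sum]
  push_cast
  rw [← Complex.mul_conj', map_sum, Finset.sum_mul_sum]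
  refine Finset.sum_congr rfl fun α _ => ?_
  rw [map_sum]
  refine Finset.sum_congr rfl fun β _ => ?_
  rw [map_monomial, rename_monomial, rename_monomial, monomial_mul, hermitianEval_monomial,
    map_mul]
  have h1 : (Finsupp.mapDomain (Sum.inl : Fin n → Fin n ⊕ Fin n) α +
      Finsupp.mapDomain Sum.inr β).comapDomain Sum.inl Sum.inl_injective.injOn = α := by
    ext j
    simp [Finsupp.mapDomain_apply Sum.inl_injective, Finsupp.mapDomain_of_notMem_range]
  have h2 : (Finsupp.mapDomain (Sum.inl : Fin n → Fin n ⊕ Fin n) α +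
      Finsupp.mapDomain Sum.inr β).comapDomain Sum.inr Sum.inr_injective.injOn = β := by
    ext j
    simp [Finsupp.mapDomain_apply Sum.inr_injective, Finsupp.mapDomain_of_notMem_range]
  rw [h1, h2]
  ring

theorem evalConj_normSqPoly (z : EuclideanSpace ℂ (Fin n)) :
    evalConj (normSqPoly n) z = ((‖z‖ ^ 2 : ℝ) : ℂ) := by
  rw [evalConj, normSqPoly, EuclideanSpace.norm_sq_eq]
  simp [Complex.mul_conj']

theorem evalConj_rename_mul (h : MvPolynomial (Fin n) ℂ) (z : EuclideanSpace ℂ (Fin n)) :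
    evalConj (rename Sum.inl h * rename Sum.inr (map (starRingEnd ℂ) h)) z =
      ((‖eval (fun i => z i) h‖ ^ 2 : ℝ) : ℂ) := by
  have h1 : eval (fun i => (starRingEnd ℂ) (z i)) (map (starRingEnd ℂ) h) =
      (starRingEnd ℂ) (eval (fun i => z i) h) := by
    rw [eval_map]
    exact (eval₂_comp (starRingEnd ℂ) (fun i => z i) h).symm
  rw [evalConj, map_mul, eval_rename, eval_rename]
  push_cast
  rw [← Complex.mul_conj', ← h1]
  rfl

/-- The identity at points of ℂⁿ is first upgraded to an identity of polynomials in z and z̄, so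
that arbitrary functionals may be applied to it; each |h_k|² then contributes |φ(h_k)|². -/
theorem MulNormPowIsSquaredNorm.hermitianEval_nonneg {r : MvPolynomial (Fin n ⊕ Fin n) ℂ} {d : ℕ}
    (h : MulNormPowIsSquaredNorm r d) (φ : (Fin n →₀ ℕ) → ℂ) :
    ∃ x : ℝ, 0 ≤ x ∧ hermitianEval φ (r * normSqPoly n ^ d) = x := by
  obtain ⟨K, h, hh⟩ := h
  have key : r * normSqPoly n ^ d -
      ∑ k, rename Sum.inl (h k) * rename Sum.inr (map (starRingEnd ℂ) (h k)) = 0 := by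
    refine eq_zero_of_evalConj _ fun z => ?_
    have h1 : evalConj (r * normSqPoly n ^ d -
        ∑ k, rename Sum.inl (h k) * rename Sum.inr (map (starRingEnd ℂ) (h k))) z =
        evalConj r z * evalConj (normSqPoly n) z ^ d -
        ∑ k, evalConj (rename Sum.inl (h k) * rename Sum.inr (map (starRingEnd ℂ) (h k))) z := by
      simp only [evalConj, map_sub, map_mul, map_pow, map_sum]
    rw [h1, evalConj_normSqPoly, sub_eq_zero]
    have h2 := hh z
    rw [pow_mul] at h2
    push_cast at h2 ⊢
    rw [h2]
    refine Finset.sum_congr rfl fun k _ => ?_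
    rw [evalConj_rename_mul]
    push_cast
    rfl
  refine ⟨∑ k, ‖∑ α ∈ (h k).support, (h k).coeff α * φ α‖ ^ 2, by positivity, ?_⟩
  rw [sub_eq_zero.1 key, map_sum, Complex.ofReal_sum]
  exact Finset.sum_congr rfl fun k _ => hermitianEval_rename_mul φ (h k)

/-- If the Hermitian form of `r` is nonpositive on all the shifts of `φ` by multi-indices of
degree `d`, then the form of `r * ‖z‖ ^ (2 * d)` is nonpositive at `φ`, and it can vanish only if
all of the former vanish. -/
theorem hermitianEval_mul_normSqPoly_pow {r : MvPolynomial (Fin n ⊕ Fin n) ℂ}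
    {q : ((Fin n →₀ ℕ) → ℂ) → ℝ} (hq : ∀ φ, hermitianEval φ r = q φ) (d : ℕ) :
    ∀ φ, (∀ γ : Fin n →₀ ℕ, γ.degree = d → q (shift γ φ) ≤ 0) →
      ∃ x : ℝ, hermitianEval φ (r * normSqPoly n ^ d) = x ∧ x ≤ 0 ∧
        (0 ≤ x → ∀ γ : Fin n →₀ ℕ, γ.degree = d → q (shift γ φ) = 0) := by
  induction d with
  | zero =>
    intro φ h
    have h0 := h 0 (map_zero _)
    rw [shift_zero] at h0
    refine ⟨q φ, by rw [pow_zero, mul_one, hq], h0, fun h1 γ hγ => ?_⟩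
    rw [(Finsupp.degree_eq_zero_iff γ).1 hγ, shift_zero]
    exact le_antisymm h0 h1
  | succ d ih =>
    intro φ h
    have h1 : ∀ i : Fin n, ∀ γ : Fin n →₀ ℕ, γ.degree = d →
        q (shift γ (shift (Finsupp.single i 1) φ)) ≤ 0 := by
      intro i γ hγ
      rw [shift_shift]
      exact h _ (by rw [map_add, hγ, Finsupp.degree_single])
    choose x hx hx0 hxq using fun i => ih (shift (Finsupp.single i 1) φ) (h1 i)
    refine ⟨∑ i, x i, ?_, Finset.sum_nonpos fun i _ => hx0 i, fun hs γ hγ => ?_⟩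
    · rw [pow_succ, ← mul_assoc, hermitianEval_mul_normSqPoly, Complex.ofReal_sum]
      exact Finset.sum_congr rfl fun i _ => hx i
    · have h2 := (Finset.sum_eq_zero_iff_of_nonpos fun i _ => hx0 i).1
        (le_antisymm (Finset.sum_nonpos fun i _ => hx0 i) hs)
      -- One variable dividing the monomial is enough: all summands vanish, in particular the one
      -- for this i.
      obtain ⟨β, i, hβ, rfl⟩ := exists_eq_add_single hγ
      rw [← shift_shift]
      exact hxq i (h2 i (Finset.mem_univ i)).ge β hβ

/-- Bihomogeneity ensures that no monomial of r is missing from the coefficient matrix. -/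
theorem hermitianEval_eq_sum {r : MvPolynomial (Fin n ⊕ Fin n) ℂ} {m : ℕ}
    (hbi : IsBihomogeneous r m m) (φ : (Fin n →₀ ℕ) → ℂ) :
    hermitianEval φ r = ∑ α : MultiIndex n m, ∑ β : MultiIndex n m,
      coeffMatrix r m α β * (φ α.1 * (starRingEnd ℂ) (φ β.1)) := by
  classical
  let e : MultiIndex n m × MultiIndex n m → (Fin n ⊕ Fin n →₀ ℕ) :=
    fun p => Finsupp.sumElim p.1.1 p.2.1
  have he1 : ∀ p, (e p).comapDomain Sum.inl Sum.inl_injective.injOn = p.1.1 := by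
    intro p; ext j; simp [e]
  have he2 : ∀ p, (e p).comapDomain Sum.inr Sum.inr_injective.injOn = p.2.1 := by
    intro p; ext j; simp [e]
  have he : Function.Injective e := by
    intro p q hpq
    refine Prod.ext (Subtype.ext ?_) (Subtype.ext ?_)
    · rw [← he1, ← he1, hpq]
    · rw [← he2, ← he2, hpq]
  let F : (Fin n ⊕ Fin n →₀ ℕ) → ℂ := fun s => hermitianEval φ (monomial s (r.coeff s))
  have hF : ∀ p : MultiIndex n m × MultiIndex n m, F (e p) =
      coeffMatrix r m p.1 p.2 * (φ p.1.1 * (starRingEnd ℂ) (φ p.2.1)) := by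
    intro p
    simp only [F]
    rw [hermitianEval_monomial, he1, he2]
    rfl
  calc hermitianEval φ r = ∑ s ∈ r.support, F s := by
        conv_lhs => rw [r.as_sum, map_sum]
    _ = ∑ s ∈ Finset.univ.map ⟨e, he⟩, F s := by
        refine Finset.sum_subset (fun s hs => ?_) fun s _ hs => ?_
        · obtain ⟨h1, h2⟩ := hbi s hs
          refine Finset.mem_map.2 ⟨(⟨s.comapDomain Sum.inl Sum.inl_injective.injOn, ?_⟩,
            ⟨s.comapDomain Sum.inr Sum.inr_injective.injOn, ?_⟩), Finset.mem_univ _, ?_⟩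
          · rw [mem_finsuppAntidiag_univ_iff, Finsupp.degree_eq_sum]
            exact h1
          · rw [mem_finsuppAntidiag_univ_iff, Finsupp.degree_eq_sum]
            exact h2
          · ext (j | j) <;> simp [e]
        · simp only [F]
          rw [notMem_support_iff.1 hs, monomial_zero, map_zero]
    _ = _ := by
        rw [Finset.sum_map, ← Finset.univ_product_univ, Finset.sum_product]
        exact Finset.sum_congr rfl fun α _ => Finset.sum_congr rfl fun β _ => hF (α, β)

theorem apply_eq_sum_eigenvalues {ι : Type*} [Fintype ι] [DecidableEq ι] {A : Matrix ι ι ℂ}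
    (hA : A.IsHermitian) (α β : ι) :
    A α β = ∑ i, (hA.eigenvalues i : ℂ) * ((hA.eigenvectorUnitary : Matrix ι ι ℂ) α i *
      (starRingEnd ℂ) ((hA.eigenvectorUnitary : Matrix ι ι ℂ) β i)) := by
  conv_lhs => rw [hA.spectral_theorem, Unitary.conjStarAlgAut_apply]
  rw [Matrix.mul_apply]
  refine Finset.sum_congr rfl fun i _ => ?_
  rw [Matrix.mul_diagonal, Matrix.star_apply]
  simp only [Function.comp_apply, Complex.coe_algebraMap, RCLike.star_def]
  change _ * (hA.eigenvalues i : ℂ) * _ = _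
  ring

theorem hermitianEval_eq_sum_eigenvalues {r : MvPolynomial (Fin n ⊕ Fin n) ℂ} {m : ℕ}
    (hbi : IsBihomogeneous r m m) (hA : (coeffMatrix r m).IsHermitian)
    (φ : (Fin n →₀ ℕ) → ℂ) :
    hermitianEval φ r = ((∑ i, hA.eigenvalues i * ‖pairing (fun α =>
      (hA.eigenvectorUnitary : Matrix (MultiIndex n m) (MultiIndex n m) ℂ) α i) φ‖ ^ 2 : ℝ) : ℂ)
        := by
  rw [hermitianEval_eq_sum hbi]
  simp only [apply_eq_sum_eigenvalues hA]
  simp only [Finset.sum_mul]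
  rw [Finset.sum_congr rfl fun α _ => Finset.sum_comm, Finset.sum_comm, Complex.ofReal_sum]
  refine Finset.sum_congr rfl fun i _ => ?_
  push_cast
  rw [← Complex.mul_conj', pairing_apply, map_sum, Finset.sum_mul_sum, Finset.mul_sum]
  refine Finset.sum_congr rfl fun α _ => ?_
  rw [Finset.mul_sum]
  refine Finset.sum_congr rfl fun β _ => ?_
  rw [map_mul]
  ring

/-- The columns of a unitary matrix form a basis, so the eigenvector forms span all forms of degree
m. -/
theorem eq_zero_of_pairing_eigenvectorUnitary {m : ℕ}
    (U : Matrix.unitaryGroup (MultiIndex n m) ℂ) {φ : (Fin n →₀ ℕ) → ℂ}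
    (h : ∀ i, pairing (fun α => (U : Matrix (MultiIndex n m) (MultiIndex n m) ℂ) α i) φ = 0)
    (α : MultiIndex n m) : φ α.1 = 0 := by
  let f : MultiIndex n m → ℂ := fun β => φ β.1
  have h1 : Matrix.vecMul f (U : Matrix (MultiIndex n m) (MultiIndex n m) ℂ) = 0 := by
    ext i
    have := h i
    rw [pairing_apply] at this
    rw [Matrix.vecMul, dotProduct, Pi.zero_apply, ← this]
    exact Finset.sum_congr rfl fun β _ => mul_comm _ _
  have h2 : f = 0 := by
    rw [← Matrix.vecMul_one f, ← Unitary.mul_star_self_of_mem U.2, ← Matrix.vecMul_vecMul, h1,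
      Matrix.zero_vecMul]
  exact congrFun h2 α

end Hermitian

/-! ### The rank and signature inequality. -/

theorem polyDim_le_macaulayIter_add {n m d : ℕ} (hm : 1 ≤ m)
    {r : MvPolynomial (Fin n ⊕ Fin n) ℂ} (hA : (coeffMatrix r m).IsHermitian)
    (hbi : IsBihomogeneous r m m) (hsq : MulNormPowIsSquaredNorm r d) :
    polyDim n (m + d) ≤ macaulayIter m (polyDim n m - (coeffMatrix r m).rank) d +
      (hermitianSignature hA).1 * polyDim n d := by
  let u : MultiIndex n m → MultiIndex n m → ℂ := fun i α =>
    (hA.eigenvectorUnitary : Matrix (MultiIndex n m) (MultiIndex n m) ℂ) α i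
  let q : ((Fin n →₀ ℕ) → ℂ) → ℝ := fun φ => ∑ i, hA.eigenvalues i * ‖pairing (u i) φ‖ ^ 2
  have hq : ∀ φ, hermitianEval φ r = q φ := hermitianEval_eq_sum_eigenvalues hbi hA
  have h1 := polyDim_le_finrank_annihilator_add u {i | 0 < hA.eigenvalues i} d
  have h2 := finrank_annihilator_zero_add_le (u := u)
    (fun φ => eq_zero_of_pairing_eigenvectorUnitary hA.eigenvectorUnitary)
    {i | hA.eigenvalues i ≠ 0}
  have h3 : Nat.card {i | hA.eigenvalues i ≠ 0} = (coeffMatrix r m).rank := by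
    rw [hA.rank_eq_card_non_zero_eigs, ← Nat.card_eq_fintype_card]
    rfl
  -- The bound `h2` with `h3` gives R ≤ D_m, so the natural-number subtraction is not truncated.
  have h4 := finrank_annihilator_le_macaulayIter hm (u := u) (s := {i | hA.eigenvalues i ≠ 0})
    (c := polyDim n m - (coeffMatrix r m).rank) (by omega) d
  -- The heart of the argument: for φ killing the positive forms times monomials, nonpositivity term
  -- by term meets nonnegativity of the squared norm, so every term vanishes and the negative forms
  -- are killed too.
  have h5 : annihilator u {i | 0 < hA.eigenvalues i} d ≤
      annihilator u {i | hA.eigenvalues i ≠ 0} d := by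
    intro φ hφ
    rw [mem_annihilator] at hφ ⊢
    have hterm : ∀ γ : Fin n →₀ ℕ, γ.degree = d → ∀ i,
        hA.eigenvalues i * ‖pairing (u i) (shift γ φ)‖ ^ 2 ≤ 0 := by
      intro γ hγ i
      rcases lt_or_ge 0 (hA.eigenvalues i) with hi | hi
      · simp [hφ.2 γ hγ i hi]
      · exact mul_nonpos_of_nonpos_of_nonneg hi (by positivity)
    obtain ⟨x, hx, -, hxq⟩ := hermitianEval_mul_normSqPoly_pow hq d φ
      fun γ hγ => Finset.sum_nonpos fun i _ => hterm γ hγ i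
    obtain ⟨y, hy, hxy⟩ := hsq.hermitianEval_nonneg φ
    have hx0 : 0 ≤ x := by
      rw [hx] at hxy
      rwa [Complex.ofReal_injective hxy]
    refine ⟨hφ.1, fun γ hγ i hi => ?_⟩
    have h0 := (Finset.sum_eq_zero_iff_of_nonpos fun i _ => hterm γ hγ i).1 (hxq hx0 γ hγ) i
      (Finset.mem_univ i)
    simpa using (mul_eq_zero.1 h0).resolve_left hi
  have h6 := Submodule.finrank_mono h5
  have h7 : Nat.card {i | 0 < hA.eigenvalues i} = (hermitianSignature hA).1 := rfl
  rw [h7] at h1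
  omega

theorem polyDim_pos {n : ℕ} (hn : 1 ≤ n) (k : ℕ) : 0 < polyDim n k :=
  Nat.choose_pos (by omega)

end SquaredNorm

theorem mainTheorem1 (n m d : ℕ) (hn : 1 ≤ n) (hm : 1 ≤ m)
    (r : MvPolynomial (Fin n ⊕ Fin n) ℂ)
    (hreal : SquaredNorm.IsRealValued r)
    (hbi : SquaredNorm.IsBihomogeneous r m m)
    (P N R : ℕ)
    (hsig : SquaredNorm.hermitianSignature (hreal.isHermitian m) = (P, N))
    (hrank : (SquaredNorm.coeffMatrix r m).rank = R)
    (hsq : SquaredNorm.MulNormPowIsSquaredNorm r d) :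
    (P : ℝ) ≥ ((SquaredNorm.polyDim n (m + d) : ℝ)
        - (SquaredNorm.macaulayIter m (SquaredNorm.polyDim n m - R) d : ℝ))
          / (SquaredNorm.polyDim n d : ℝ) ∧
    ∀ (J : ℕ) (k : ℕ → ℕ),
      SquaredNorm.IsMacaulayRep m (SquaredNorm.polyDim n m - R) J k →
        SquaredNorm.macaulayIter m (SquaredNorm.polyDim n m - R) d
            = ∑ j ∈ Finset.Icc J m, (k j + d).choose (j + d) ∧
        (P : ℝ) ≥ ((SquaredNorm.polyDim n (m + d) : ℝ)
            - ((∑ j ∈ Finset.Icc J m, (k j + d).choose (j + d) : ℕ) : ℝ))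
              / (SquaredNorm.polyDim n d : ℝ) := by
  have h := SquaredNorm.polyDim_le_macaulayIter_add hm (hreal.isHermitian m) hbi hsq
  rw [hsig, hrank] at h
  have hmain : (P : ℝ) ≥ ((SquaredNorm.polyDim n (m + d) : ℝ)
      - (SquaredNorm.macaulayIter m (SquaredNorm.polyDim n m - R) d : ℝ))
        / (SquaredNorm.polyDim n d : ℝ) := by
    rw [ge_iff_le, div_le_iff₀ (Nat.cast_pos.2 (SquaredNorm.polyDim_pos hn d)), sub_le_iff_le_add']
    exact_mod_cast h
  refine ⟨hmain, fun J k hk => ?_⟩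
  have hsum := SquaredNorm.macaulayIter_eq_sum hm hk d
  exact ⟨hsum, hsum ▸ hmain⟩
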